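/- Let $N\ge 2$, let $x_0<x_1<\cdots<x_N$ be equally spaced real numbers, i.e. $x_n-x_{n-1}=(x_N-x_0)/N$ for $1\le n\le N$, and let $y_0,\dots,y_N\in\mathbb R$. For $1\le n\le N$ let $0\le \ell(n)<r(n)\le N$, $I_n=[x_{n-1},x_n]$, $D_n=[x_{\ell(n)},x_{r(n)}]$, let $L_n(x)=a_nx+b_n$ be a contraction mapping $D_n$ bijectively onto $I_n$, and let $S_n,q_n:D_n\to\mathbb R$ be continuous functions of bounded variation with $|S_n(x)|<1$ on $D_n$, such that $W_n(x,y)=(L_n(x),S_n(x)y+q_n(x))$ maps $\{(x_{\ell(n)},y_{\ell(n)}),(x_{r(n)},y_{r(n)})\}$ onto $\{(x_{n-1},y_{n-1}),(x_n,y_n)\}$. For $i,j\in\{1,\dots,N\}$ there is an edge from $j$ to $i$ if $I_j\subset D_i$. A nonempty set $V\subset\{1,\dots,N\}$ is strongly connected if for all $i,j\in V$ (including $i=j$) there is a path in $V$ with at least one edge from $j$ to $i$; a strongly connected component is a strongly connected set that is maximal for inclusion. Let $\Lambda=\{\alpha_1<\cdots<\alpha_d\}$ be a strongly connected component, and suppose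 that there is an integer $T\ge2$ with $|D_n|/|I_n|=T$ for all $n\in\Lambda$. Let $B_0=\bigcup_{n\in\Lambda}D_n$, $B_k=\bigcup_{n\in\Lambda}L_n(B_{k-1}\cap D_n)$ for $k\ge1$, and $K=\bigcap_{k\ge0}B_k$. Let $\mathcal B_0=\{D_n:n\in\Lambda\}$ and $\mathcal B_k=\{L_n(E):n\in\Lambda,\ E\in\mathcal B_{k-1},\ E\subset D_n\}$ for $k\ge1$. For $k\ge1$, $1\le t\le d$ and $1\le j\le T^{k-1}$ put $$I^k_{(t-1)T^{k-1}+j}=\Big[x_{\alpha_t-1}+\frac{(j-1)(x_N-x_0)}{N\,T^{k-1}},\ x_{\alpha_t-1}+\frac{j(x_N-x_0)}{N\,T^{k-1}}\Big],$$ and let $\Theta_k=\{1\le i\le dT^{k-1}: I^k_i\in\mathcal B_k\}$. For $1\le i\le dT^{k-1}$ let $n=n(i)$ be the unique index with $I_i^k\subset I_n$, and let $D_i^k=L_n^{-1}(I_i^k)\subset D_n$. Let $\overline M_k$ and $\underline M_k$ be the $dT^{k-1}\times dT^{k-1}$ matrices with entries $$(\overline M_k)_{i,j}=\max_{x\in I_j^k}|S_{n(i)}(x)|,\qquad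 (\underline M_k)_{i,j}=\min_{x\in I_j^k}|S_{n(i)}(x)|\qquad\text{if } I_j^k\subset D_i^k,$$ and both entries equal to $0$ otherwise. Let $A|_{\Theta}$ denote the principal submatrix of $A$ with rows and columns in $\Theta$, and $\rho(A)$ the largest modulus of a complex eigenvalue of $A$. Then: 1. The sequence $\{\rho(\overline M_k|_{\Theta_k})\}_{k\ge1}$ is decreasing (in the wide sense), and hence converges to a real limit, denoted by $\rho_\Lambda$. 2. The sequence $\{\rho(\underline M_k|_{\Theta_k})\}_{k\ge1}$ is increasing (in the wide sense), and it converges to a real limit. If moreover $S_n$ is positive on $D_n\cap K$ for all $n\in\Lambda$, then $\lim_{k\to\infty}\rho(\underline M_k|_{\Theta_k})=\rho_\Lambda$. -/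

import Mathlib

/-- The data of a generalized affine recurrent iterated function system with `N` maps.
The indices `1, …, N` of the maps are represented by `Fin N` (so `n : Fin N` stands for `n + 1`),
and the nodes `0, …, N` by `Fin (N + 1)`. -/
structure RecurrentData (N : ℕ) where
  /-- abscissae `x_0, …, x_N` -/
  x : Fin (N + 1) → ℝ
  /-- ordinates `y_0, …, y_N` -/
  y : Fin (N + 1) → ℝ
  /-- the index of the left endpoint of `D_n` -/
  lo : Fin N → Fin (N + 1)
  /-- the index of the right endpoint of `D_n` -/
  hi : Fin N → Fin (N + 1)
  /-- `L_n(t) = a_n t + b_n` -/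
  a : Fin N → ℝ
  b : Fin N → ℝ
  /-- vertical scaling functions; only the values of `S n` on `D n` are relevant -/
  S : Fin N → ℝ → ℝ
  /-- `F_n(t, u) = S_n(t) u + q_n(t)`; only the values of `q n` on `D n` are relevant -/
  q : Fin N → ℝ → ℝ

namespace RecurrentData

variable {N : ℕ} (P : RecurrentData N)

/-- `I_n`, the interval between two consecutive nodes. -/
def I (n : Fin N) : Set ℝ := Set.Icc (P.x n.castSucc) (P.x n.succ)

/-- `D_n`, the domain of `L_n`. -/
def D (n : Fin N) : Set ℝ := Set.Icc (P.x (P.lo n)) (P.x (P.hi n))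

/-- The affine map `L_n`. -/
def L (n : Fin N) (t : ℝ) : ℝ := P.a n * t + P.b n

/-- `W_n(t, u) = (L_n(t), S_n(t) u + q_n(t))`. -/
def W (n : Fin N) (p : ℝ × ℝ) : ℝ × ℝ := (P.L n p.1, P.S n p.1 * p.2 + P.q n p.1)

/-- The data determine a generalized affine recurrent fractal interpolation function with
equally spaced nodes and with continuous vertical scaling functions `S_n` and offsets `q_n` of
bounded variation, `|S_n| < 1`. (The maps `L_n` may reverse the orientation.) -/
structure IsGeneralizedAffine : Prop where
  two_le : 2 ≤ N
  x_strictMono : StrictMono P.x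
  lo_lt_hi : ∀ n, P.lo n < P.hi n
  L_bijOn : ∀ n, Set.BijOn (P.L n) (P.D n) (P.I n)
  L_contractive : ∀ n, |P.a n| < 1
  interpolation : ∀ n,
    P.W n '' {(P.x (P.lo n), P.y (P.lo n)), (P.x (P.hi n), P.y (P.hi n))} =
      {(P.x n.castSucc, P.y n.castSucc), (P.x n.succ, P.y n.succ)}
  equally_spaced : ∀ n : Fin N,
    P.x n.succ - P.x n.castSucc = (P.x (Fin.last N) - P.x 0) / N
  S_continuousOn : ∀ n, ContinuousOn (P.S n) (P.D n)
  S_boundedVariationOn : ∀ n, BoundedVariationOn (P.S n) (P.D n)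
  S_abs_lt_one : ∀ n, ∀ t ∈ P.D n, |P.S n t| < 1
  q_continuousOn : ∀ n, ContinuousOn (P.q n) (P.D n)
  q_boundedVariationOn : ∀ n, BoundedVariationOn (P.q n) (P.D n)

/-- There is an edge from `j` to `i`. -/
def Edge (j i : Fin N) : Prop := P.I j ⊆ P.D i

/-- There is a path with at least one edge in `V` from `j` to `i`. -/
def HasPath (V : Finset (Fin N)) (j i : Fin N) : Prop :=
  Relation.TransGen (fun u v => u ∈ V ∧ v ∈ V ∧ P.Edge u v) j i

/-- `V` is nonempty and any two elements of `V` (also an element and itself) are joined by a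
path in `V`. -/
def StronglyConnected (V : Finset (Fin N)) : Prop :=
  V.Nonempty ∧ ∀ i ∈ V, ∀ j ∈ V, P.HasPath V j i

/-- Strongly connected components: the strongly connected sets that are maximal for inclusion. -/
def IsComponent (V : Finset (Fin N)) : Prop := Maximal P.StronglyConnected V

/-- The basic sets `B_{r,k}` of the local system `{L_n : n ∈ Λ}`. -/
def basicSet (Λ : Finset (Fin N)) : ℕ → Set ℝ
  | 0 => ⋃ n ∈ Λ, P.D n
  | k + 1 => ⋃ n ∈ Λ, P.L n '' (basicSet Λ k ∩ P.D n)

/-- `K_r`, the intersection of the basic sets. -/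
def limitSet (Λ : Finset (Fin N)) : Set ℝ := ⋂ k, P.basicSet Λ k

/-- The family of the basic intervals of level `k` of the local system `{L_n : n ∈ Λ}`. -/
def basicIntervals (Λ : Finset (Fin N)) : ℕ → Set (Set ℝ)
  | 0 => {E | ∃ n ∈ Λ, E = P.D n}
  | k + 1 => {E | ∃ n ∈ Λ, ∃ E' ∈ basicIntervals Λ k, E' ⊆ P.D n ∧ E = P.L n '' E'}

/-- The index set `{1, …, d_r T_r^{k-1}}` (starting from `0` here), where `d_r = #Λ`. It is used
for `k ≥ 1` only. -/
abbrev CellIndex (Λ : Finset (Fin N)) (T k : ℕ) : Type := Fin (Λ.card * T ^ (k - 1))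

/-- For `i = t T^{k-1} + j` with `0 ≤ j < T^{k-1}` this is the `t`-th element of `Λ` in
increasing order, that is, the unique `n` with `I_{r,i}^k ⊆ I_n`. -/
def owner (Λ : Finset (Fin N)) (T k : ℕ) (i : CellIndex Λ T k) : Fin N :=
  Λ.orderEmbOfFin rfl i.divNat

/-- The interval `I_{r,i}^k`: for `i = t T^{k-1} + j`, the `j`-th (from `0`) of the `T^{k-1}`
subintervals of equal length of `I_n`, where `n` is the `t`-th element of `Λ`. -/
def cell (Λ : Finset (Fin N)) (T k : ℕ) (i : CellIndex Λ T k) : Set ℝ :=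
  Set.Icc
    (P.x (owner Λ T k i).castSucc
      + ((i.modNat : ℕ) : ℝ) * (P.x (Fin.last N) - P.x 0) / (N * (T : ℝ) ^ (k - 1)))
    (P.x (owner Λ T k i).castSucc
      + (((i.modNat : ℕ) : ℝ) + 1) * (P.x (Fin.last N) - P.x 0) / (N * (T : ℝ) ^ (k - 1)))

/-- `D_{r,i}^k = L_n⁻¹(I_{r,i}^k)` for the map `L_n : D_n → I_n` with `I_{r,i}^k ⊆ I_n`. -/
def cellPreimage (Λ : Finset (Fin N)) (T k : ℕ) (i : CellIndex Λ T k) : Set ℝ :=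
  P.D (owner Λ T k i) ∩ P.L (owner Λ T k i) ⁻¹' P.cell Λ T k i

open Classical in
/-- `Θ_{r,k}`, the indices of the level `k` cells that are basic intervals of level `k`. -/
noncomputable def Theta (Λ : Finset (Fin N)) (T k : ℕ) : Finset (CellIndex Λ T k) :=
  Finset.univ.filter fun i => P.cell Λ T k i ∈ P.basicIntervals Λ k

open Classical in
/-- The level `k` upper vertical scaling matrix. -/
noncomputable def upperMatrix (Λ : Finset (Fin N)) (T k : ℕ) :
    Matrix (CellIndex Λ T k) (CellIndex Λ T k) ℝ :=
  Matrix.of fun i j =>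
    if P.cell Λ T k j ⊆ P.cellPreimage Λ T k i then
      sSup ((fun t => |P.S (owner Λ T k i) t|) '' P.cell Λ T k j)
    else 0

open Classical in
/-- The level `k` lower vertical scaling matrix. -/
noncomputable def lowerMatrix (Λ : Finset (Fin N)) (T k : ℕ) :
    Matrix (CellIndex Λ T k) (CellIndex Λ T k) ℝ :=
  Matrix.of fun i j =>
    if P.cell Λ T k j ⊆ P.cellPreimage Λ T k i then
      sInf ((fun t => |P.S (owner Λ T k i) t|) '' P.cell Λ T k j)
    else 0

end RecurrentData

/-- The spectral radius of a real square matrix: the largest modulus of its complex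
eigenvalues. -/
noncomputable def matrixSpectralRadius {ι : Type*} [Fintype ι] [DecidableEq ι]
    (A : Matrix ι ι ℝ) : ℝ :=
  (spectralRadius ℂ (A.map (fun t : ℝ => (t : ℂ)))).toReal

/-- The principal submatrix of `A` with rows and columns in `Θ`. -/
def principalSubmatrix {ι : Type*} (A : Matrix ι ι ℝ) (Θ : Finset ι) : Matrix Θ Θ ℝ :=
  A.submatrix Subtype.val Subtype.val

namespace RecurrentData

variable {N : ℕ} (P : RecurrentData N)

/-- The spectral radius of the upper restricted vertical scaling matrix of level `k`. -/
noncomputable def upperRadius (Λ : Finset (Fin N)) (T k : ℕ) : ℝ :=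
  matrixSpectralRadius (principalSubmatrix (P.upperMatrix Λ T k) (P.Theta Λ T k))

/-- The spectral radius of the lower restricted vertical scaling matrix of level `k`. -/
noncomputable def lowerRadius (Λ : Finset (Fin N)) (T k : ℕ) : ℝ :=
  matrixSpectralRadius (principalSubmatrix (P.lowerMatrix Λ T k) (P.Theta Λ T k))

end RecurrentData

/-! By Gelfand's formula, with the maximal column sum as norm, the spectral radius of a nonnegative
matrix is governed by the column sums of its powers, so everything reduces to comparing such sums
between consecutive levels.

Equal spacing and the common ratio `T` make each `L_n` with `n ∈ Λ` a similarity of ratio `1 / T`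
that carries grid intervals in `D_n` to grid intervals one level finer. Cells thus become natural
numbers, the cell containing `c` one level up is `c / T`, and this parent map commutes with the maps
`L_n` (`childCode_succ_div`). Level `k = m + 1` of the statement is the grid of level `m`.

Let `π` be the parent map on basic cells. An edge from `j` to `i'` projects to an edge from `π j` to
`π i'`, and an edge from `π j` to `i` lifts to exactly one edge from `j` into the fibre over `i`.
Since the cell of `j` lies in that of `π j`, passing to the finer level lowers the maxima and raises
the minima. Hence fibre sums of the upper matrix are at most the coarser entry, and those of the
lower matrix at least that entry. Both monotonicity claims follow by induction on the power.

If the scalings are positive on `K`, compactness bounds them below on some `B_k`. Uniform continuity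
then gives maximum at most `1 + η` times minimum on all fine basic cells, so the upper radius is
eventually at most `1 + η` times the lower one, and `η → 0` identifies the limits. -/

open Filter Topology

/-! ### Spectral radii of nonnegative matrices. -/

section MatrixSpectralRadius

variable {ι κ : Type*} [Fintype ι] [DecidableEq ι] [Fintype κ] [DecidableEq κ]

/-- The largest column sum of the moduli of the entries. -/
noncomputable def columnNorm (A : Matrix ι ι ℝ) : NNReal :=
  Finset.univ.sup fun j => ∑ i, ‖A i j‖₊

attribute [local instance] Matrix.linftyOpNormedRing Matrix.linftyOpNormedAlgebra

/-- Gelfand's formula for the norm of the maximal column sum. -/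
theorem tendsto_columnNorm_pow (A : Matrix ι ι ℝ) :
    Tendsto (fun p : ℕ => ((columnNorm (A ^ p) : ℝ) ^ (1 / p : ℝ))) atTop
      (𝓝 (matrixSpectralRadius A)) := by
  set B : Matrix ι ι ℂ := A.map (fun t : ℝ => (t : ℂ)) with hB
  -- The `linfty` operator norm is the maximal row sum; transposing turns it into the column sum and
  -- keeps the spectrum.
  have hspec : spectralRadius ℂ B = spectralRadius ℂ B.transpose := by
    have : spectrum ℂ B = spectrum ℂ B.transpose := by
      ext z
      rw [spectrum.mem_iff, spectrum.mem_iff, not_iff_not, Matrix.isUnit_iff_isUnit_det,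
        Matrix.isUnit_iff_isUnit_det, ← Matrix.det_transpose, Matrix.transpose_sub,
        Matrix.algebraMap_eq_diagonal, Matrix.diagonal_transpose]
    simp only [spectralRadius, this]
  have hpow : ∀ p : ℕ, ‖B.transpose ^ p‖₊ = columnNorm (A ^ p) := by
    intro p
    have h1 : B ^ p = (A ^ p).map (fun t : ℝ => (t : ℂ)) :=
      (Matrix.map_pow A (Complex.ofRealHom) p).symm
    rw [← Matrix.transpose_pow, h1, Matrix.linfty_opNNNorm_def, columnNorm]
    simp
  have h := spectrum.pow_nnnorm_pow_one_div_tendsto_nhds_spectralRadius B.transpose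
  have hfin : spectralRadius ℂ B.transpose ≠ ⊤ := by
    rcases isEmpty_or_nonempty ι with hι | hι
    · simp [spectralRadius, spectrum.of_subsingleton]
    · exact ((spectrum.spectralRadius_le_nnnorm (𝕜 := ℂ) B.transpose).trans_lt
        ENNReal.coe_lt_top).ne
  have h' := (ENNReal.tendsto_toReal hfin).comp h
  rw [matrixSpectralRadius, ← hB, hspec]
  refine h'.congr fun p => ?_
  simp [hpow, ← ENNReal.toReal_rpow]

theorem matrixSpectralRadius_nonneg (A : Matrix ι ι ℝ) : 0 ≤ matrixSpectralRadius A :=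
  ENNReal.toReal_nonneg

theorem matrixSpectralRadius_le_of_columnNorm_pow_le {A : Matrix κ κ ℝ} {B : Matrix ι ι ℝ}
    {c : ℝ} (hc : 0 ≤ c) (h : ∀ p, (columnNorm (A ^ p) : ℝ) ≤ c ^ p * columnNorm (B ^ p)) :
    matrixSpectralRadius A ≤ c * matrixSpectralRadius B := by
  refine le_of_tendsto_of_tendsto (tendsto_columnNorm_pow A)
    ((tendsto_columnNorm_pow B).const_mul c) ?_
  filter_upwards [eventually_ne_atTop 0] with p hp
  calc ((columnNorm (A ^ p) : ℝ) ^ (1 / p : ℝ))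
      ≤ (c ^ p * columnNorm (B ^ p)) ^ (1 / p : ℝ) := by
        gcongr
        exact h p
    _ = c * (columnNorm (B ^ p) : ℝ) ^ (1 / p : ℝ) := by
        rw [Real.mul_rpow (by positivity) (by positivity), one_div,
          Real.pow_rpow_inv_natCast hc hp]

theorem matrix_pow_nonneg {A : Matrix ι ι ℝ} (hA : ∀ i j, 0 ≤ A i j) (p : ℕ) (i j : ι) :
    0 ≤ (A ^ p) i j := by
  induction p generalizing i j with
  | zero => rw [pow_zero, Matrix.one_apply]; split_ifs <;> simp
  | succ p ih =>
    rw [pow_succ, Matrix.mul_apply]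
    exact Finset.sum_nonneg fun l _ => mul_nonneg (ih i l) (hA l j)

omit [DecidableEq ι] in
theorem columnNorm_eq_of_nonneg {A : Matrix ι ι ℝ} (hA : ∀ i j, 0 ≤ A i j) :
    columnNorm A = Finset.univ.sup fun j => (∑ i, A i j).toNNReal := by
  unfold columnNorm
  congr 1
  ext j
  rw [Real.coe_toNNReal _ (Finset.sum_nonneg fun i _ => hA i j)]
  push_cast
  exact Finset.sum_congr rfl fun i _ => by rw [Real.norm_of_nonneg (hA i j)]

theorem columnSum_pow_succ (A : Matrix ι ι ℝ) (p : ℕ) (j : ι) :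
    ∑ i, (A ^ (p + 1)) i j = ∑ l, (∑ i, (A ^ p) i l) * A l j := by
  simp only [pow_succ, Matrix.mul_apply, Finset.sum_mul]
  exact Finset.sum_comm

/-- If the sums of `A` over the fibres of `π` are dominated by `B`, so are the column sums of the
powers. -/
theorem columnSum_pow_le_of_fiber_le {A : Matrix κ κ ℝ} {B : Matrix ι ι ℝ} {π : κ → ι}
    (hA : ∀ i j, 0 ≤ A i j) (hB : ∀ i j, 0 ≤ B i j)
    (h : ∀ i j, ∑ i' with π i' = i, A i' j ≤ B i (π j)) (p : ℕ) (j : κ) :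
    ∑ i, (A ^ p) i j ≤ ∑ i, (B ^ p) i (π j) := by
  induction p generalizing j with
  | zero => simp [Matrix.one_apply]
  | succ p ih =>
    rw [columnSum_pow_succ, columnSum_pow_succ]
    calc ∑ l, (∑ i, (A ^ p) i l) * A l j
        ≤ ∑ l, (∑ i, (B ^ p) i (π l)) * A l j :=
          Finset.sum_le_sum fun l _ => mul_le_mul_of_nonneg_right (ih l) (hA l j)
      _ = ∑ s, ∑ l with π l = s, (∑ i, (B ^ p) i (π l)) * A l j :=
          (Finset.sum_fiberwise _ _ _).symm
      _ = ∑ s, (∑ i, (B ^ p) i s) * ∑ l with π l = s, A l j := by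
          refine Finset.sum_congr rfl fun s _ => ?_
          rw [Finset.mul_sum]
          exact Finset.sum_congr rfl fun l hl => by rw [(Finset.mem_filter.1 hl).2]
      _ ≤ _ := Finset.sum_le_sum fun s _ => mul_le_mul_of_nonneg_left (h s j)
          (Finset.sum_nonneg fun i _ => matrix_pow_nonneg hB p i s)

/-- If the sums of `A` over the fibres of `π` dominate `B`, so do the column sums of the
powers. -/
theorem le_columnSum_pow_of_le_fiber {A : Matrix κ κ ℝ} {B : Matrix ι ι ℝ} {π : κ → ι}
    (hA : ∀ i j, 0 ≤ A i j) (hB : ∀ i j, 0 ≤ B i j)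
    (h : ∀ i j, B i (π j) ≤ ∑ i' with π i' = i, A i' j) (p : ℕ) (j : κ) :
    ∑ i, (B ^ p) i (π j) ≤ ∑ i, (A ^ p) i j := by
  induction p generalizing j with
  | zero => simp [Matrix.one_apply]
  | succ p ih =>
    rw [columnSum_pow_succ, columnSum_pow_succ]
    calc ∑ s, (∑ i, (B ^ p) i s) * B s (π j)
        ≤ ∑ s, (∑ i, (B ^ p) i s) * ∑ l with π l = s, A l j :=
          Finset.sum_le_sum fun s _ => mul_le_mul_of_nonneg_left (h s j)
            (Finset.sum_nonneg fun i _ => matrix_pow_nonneg hB p i s)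
      _ = ∑ s, ∑ l with π l = s, (∑ i, (B ^ p) i (π l)) * A l j := by
          refine Finset.sum_congr rfl fun s _ => ?_
          rw [Finset.mul_sum]
          exact Finset.sum_congr rfl fun l hl => by rw [(Finset.mem_filter.1 hl).2]
      _ = ∑ l, (∑ i, (B ^ p) i (π l)) * A l j := Finset.sum_fiberwise _ _ _
      _ ≤ ∑ l, (∑ i, (A ^ p) i l) * A l j :=
          Finset.sum_le_sum fun l _ => mul_le_mul_of_nonneg_right (ih l) (hA l j)

/-- Column `j` of `A ^ p` is compared with column `π j` of `B ^ p`, so `π` may miss some columns of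
`B`. -/
theorem matrixSpectralRadius_le_of_fiber_le {A : Matrix κ κ ℝ} {B : Matrix ι ι ℝ} (π : κ → ι)
    (hA : ∀ i j, 0 ≤ A i j) (hB : ∀ i j, 0 ≤ B i j)
    (h : ∀ i j, ∑ i' with π i' = i, A i' j ≤ B i (π j)) :
    matrixSpectralRadius A ≤ matrixSpectralRadius B := by
  have := matrixSpectralRadius_le_of_columnNorm_pow_le (A := A) (B := B) zero_le_one fun p => by
    rw [one_pow, one_mul, NNReal.coe_le_coe, columnNorm_eq_of_nonneg (matrix_pow_nonneg hA p),
      columnNorm_eq_of_nonneg (matrix_pow_nonneg hB p)]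
    refine Finset.sup_le fun j _ => ?_
    refine le_trans (Real.toNNReal_le_toNNReal (columnSum_pow_le_of_fiber_le hA hB h p j)) ?_
    exact Finset.le_sup (f := fun j => (∑ i, (B ^ p) i j).toNNReal) (Finset.mem_univ (π j))
  simpa using this

/-- Surjectivity is needed here: each column of `B ^ p` must be compared with some column of `A ^
p`. -/
theorem le_matrixSpectralRadius_of_le_fiber {A : Matrix κ κ ℝ} {B : Matrix ι ι ℝ} (π : κ → ι)
    (hπ : Function.Surjective π) (hA : ∀ i j, 0 ≤ A i j) (hB : ∀ i j, 0 ≤ B i j)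
    (h : ∀ i j, B i (π j) ≤ ∑ i' with π i' = i, A i' j) :
    matrixSpectralRadius B ≤ matrixSpectralRadius A := by
  have := matrixSpectralRadius_le_of_columnNorm_pow_le (A := B) (B := A) zero_le_one fun p => by
    rw [one_pow, one_mul, NNReal.coe_le_coe, columnNorm_eq_of_nonneg (matrix_pow_nonneg hA p),
      columnNorm_eq_of_nonneg (matrix_pow_nonneg hB p)]
    refine Finset.sup_le fun s _ => ?_
    obtain ⟨j, rfl⟩ := hπ s
    refine le_trans (Real.toNNReal_le_toNNReal (le_columnSum_pow_of_le_fiber hA hB h p j)) ?_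
    exact Finset.le_sup (f := fun j => (∑ i, (A ^ p) i j).toNNReal) (Finset.mem_univ j)
  simpa using this

theorem matrix_pow_le_of_le_mul {A B : Matrix ι ι ℝ} {c : ℝ} (hA : ∀ i j, 0 ≤ A i j)
    (h : ∀ i j, A i j ≤ c * B i j) (p : ℕ) (i j : ι) :
    (A ^ p) i j ≤ c ^ p * (B ^ p) i j := by
  induction p generalizing i j with
  | zero => simp
  | succ p ih =>
    rw [pow_succ, pow_succ, pow_succ, Matrix.mul_apply, Matrix.mul_apply, Finset.mul_sum]
    refine Finset.sum_le_sum fun l _ => ?_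
    calc (A ^ p) i l * A l j ≤ (c ^ p * (B ^ p) i l) * (c * B l j) :=
          mul_le_mul (ih i l) (h l j) (hA l j) ((matrix_pow_nonneg hA p i l).trans (ih i l))
      _ = _ := by ring

theorem matrixSpectralRadius_le_mul {A B : Matrix ι ι ℝ} {c : ℝ} (hc : 0 ≤ c)
    (hA : ∀ i j, 0 ≤ A i j) (hB : ∀ i j, 0 ≤ B i j) (h : ∀ i j, A i j ≤ c * B i j) :
    matrixSpectralRadius A ≤ c * matrixSpectralRadius B := by
  refine matrixSpectralRadius_le_of_columnNorm_pow_le hc fun p => ?_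
  rw [columnNorm_eq_of_nonneg (matrix_pow_nonneg hA p),
    columnNorm_eq_of_nonneg (matrix_pow_nonneg hB p)]
  lift c to NNReal using hc
  rw [← NNReal.coe_pow, ← NNReal.coe_mul, NNReal.coe_le_coe]
  refine Finset.sup_le fun j _ => ?_
  have h1 : ∑ i, (A ^ p) i j ≤ (c ^ p : NNReal) * ∑ i, (B ^ p) i j := by
    rw [Finset.mul_sum]
    exact Finset.sum_le_sum fun i _ => by
      simpa using matrix_pow_le_of_le_mul hA h p i j
  refine (Real.toNNReal_le_toNNReal h1).trans ?_
  rw [Real.toNNReal_mul (NNReal.coe_nonneg _), Real.toNNReal_coe]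
  gcongr
  exact Finset.le_sup (f := fun j => (∑ i, (B ^ p) i j).toNNReal) (Finset.mem_univ j)

theorem matrixSpectralRadius_mono {A B : Matrix ι ι ℝ} (hA : ∀ i j, 0 ≤ A i j)
    (h : ∀ i j, A i j ≤ B i j) : matrixSpectralRadius A ≤ matrixSpectralRadius B := by
  have := matrixSpectralRadius_le_mul (B := B) zero_le_one hA
    (fun i j => (hA i j).trans (h i j)) (fun i j => (h i j).trans_eq (one_mul _).symm)
  rwa [one_mul] at this

end MatrixSpectralRadius

/-! ### Grid intervals and their integer codes. -/

namespace RecurrentData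

variable {N : ℕ} (P : RecurrentData N)

/-- The distance between consecutive nodes. -/
noncomputable def step : ℝ := (P.x (Fin.last N) - P.x 0) / N

/-- The `c`-th interval of the uniform grid of mesh `step / T ^ m` starting from the first node. -/
noncomputable def grid (T m c : ℕ) : Set ℝ :=
  Set.Icc (P.x 0 + c * (P.step / (T : ℝ) ^ m)) (P.x 0 + ((c : ℝ) + 1) * (P.step / (T : ℝ) ^ m))

/-- The `c`-th grid interval of level `m` lies in `D_n`. -/
def InDomain (T m : ℕ) (n : Fin N) (c : ℕ) : Prop :=
  (P.lo n : ℕ) * T ^ m ≤ c ∧ c < (P.hi n : ℕ) * T ^ m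

open Classical in
/-- The index of the image of the `c`-th grid interval of level `m` under `L_n`. -/
noncomputable def childCode (T m : ℕ) (n : Fin N) (c : ℕ) : ℕ :=
  if 0 < P.a n then (n : ℕ) * T ^ (m + 1) + (c - (P.lo n : ℕ) * T ^ m)
  else (n : ℕ) * T ^ (m + 1) + ((P.hi n : ℕ) * T ^ m - 1 - c)

/-- The indices of the basic intervals of level `m + 1` in the grid of level `m`. -/
def basicCodes (Λ : Finset (Fin N)) (T : ℕ) : ℕ → Set ℕ
  | 0 => {c | ∃ n ∈ Λ, c = (n : ℕ)}
  | m + 1 => {c | ∃ n ∈ Λ, ∃ c' ∈ basicCodes Λ T m, P.InDomain T m n c' ∧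
      c = P.childCode T m n c'}

/-- The index of a cell in the grid. -/
def code (Λ : Finset (Fin N)) (T m : ℕ) (i : CellIndex Λ T (m + 1)) : ℕ :=
  (owner Λ T (m + 1) i : ℕ) * T ^ m + (i.modNat : ℕ)

variable {P} {Λ : Finset (Fin N)} {T : ℕ}

namespace IsGeneralizedAffine

variable (hP : P.IsGeneralizedAffine)
include hP

theorem x_eq (i : Fin (N + 1)) : P.x i = P.x 0 + (i : ℕ) * P.step := by
  induction i using Fin.induction with
  | zero => simp
  | succ i ih =>
    have h := hP.equally_spaced i
    rw [Fin.val_castSucc] at ih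
    rw [Fin.val_succ]
    push_cast
    unfold step at ih ⊢
    linarith

theorem step_pos : 0 < P.step := by
  have hN : 0 < N := by have := hP.two_le; omega
  have h : P.x 0 < P.x (Fin.last N) := hP.x_strictMono (by
    rw [Fin.lt_def]; simpa using hN)
  exact div_pos (by linarith) (by exact_mod_cast hN)

theorem I_eq (n : Fin N) :
    P.I n = Set.Icc (P.x 0 + (n : ℕ) * P.step) (P.x 0 + ((n : ℕ) + 1 : ℕ) * P.step) := by
  rw [I, hP.x_eq n.castSucc, hP.x_eq n.succ, Fin.val_castSucc, Fin.val_succ]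

theorem D_eq (n : Fin N) :
    P.D n = Set.Icc (P.x 0 + (P.lo n : ℕ) * P.step) (P.x 0 + (P.hi n : ℕ) * P.step) := by
  rw [D, hP.x_eq (P.lo n), hP.x_eq (P.hi n)]

theorem I_eq_grid (n : Fin N) : P.I n = P.grid T 0 n := by
  rw [hP.I_eq, grid]
  push_cast
  simp

theorem hi_eq {n : Fin N}
    (h : (P.x (P.hi n) - P.x (P.lo n)) / (P.x n.succ - P.x n.castSucc) = T) :
    (P.hi n : ℕ) = P.lo n + T := by
  have hs := hP.step_pos
  rw [hP.equally_spaced n, hP.x_eq (P.hi n), hP.x_eq (P.lo n)] at h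
  change _ / P.step = _ at h
  rw [div_eq_iff hs.ne'] at h
  have h2 : ((P.hi n : ℕ) : ℝ) = (P.lo n : ℕ) + T := by
    apply mul_right_cancel₀ hs.ne'
    linarith
  exact_mod_cast h2

/-- The two possible forms of `L_n`, according to its orientation. -/
theorem L_eq {n : Fin N} (hT : 2 ≤ T) (hn : (P.hi n : ℕ) = P.lo n + T) :
    (0 < P.a n ∧ ∀ t, P.L n t =
        P.x 0 + (n : ℕ) * P.step + (t - (P.x 0 + (P.lo n : ℕ) * P.step)) / T) ∨
      (¬ 0 < P.a n ∧ ∀ t, P.L n t =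
        P.x 0 + (n : ℕ) * P.step + (P.x 0 + (P.hi n : ℕ) * P.step - t) / T) := by
  have hs := hP.step_pos
  have hT0 : (0 : ℝ) < T := by exact_mod_cast (by omega : 0 < T)
  have him := (hP.L_bijOn n).image_eq
  rw [hP.D_eq, hP.I_eq] at him
  have hnR : ((P.hi n : ℕ) : ℝ) = (P.lo n : ℕ) + T := by exact_mod_cast hn
  set u := P.x 0 + (P.lo n : ℕ) * P.step with hu
  set v := P.x 0 + (P.hi n : ℕ) * P.step with hv
  have huv : v = u + T * P.step := by rw [hv, hu, hnR]; ring
  have huv' : u ≤ v := by rw [huv]; nlinarith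
  set p := P.x 0 + (n : ℕ) * P.step with hp
  have hq : P.x 0 + ((n : ℕ) + 1 : ℕ) * P.step = p + P.step := by rw [hp]; push_cast; ring
  rw [hq] at him
  have hL : P.L n = fun t => P.a n * t + P.b n := rfl
  -- Matching the endpoints of `L_n(D_n)` and `I_n` determines slope and offset; a negative slope
  -- exchanges the endpoints, and slope zero would collapse `I_n` to a point.
  rcases lt_trichotomy (P.a n) 0 with ha | ha | ha
  · right
    refine ⟨ha.not_gt, ?_⟩
    have h2 : P.L n '' Set.Icc u v = Set.Icc (P.a n * v + P.b n) (P.a n * u + P.b n) := by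
      ext y
      simp only [hL, Set.mem_image, Set.mem_Icc]
      constructor
      · rintro ⟨t, ⟨h1, h2⟩, rfl⟩
        constructor <;> nlinarith
      · rintro ⟨h1, h2⟩
        refine ⟨(y - P.b n) / P.a n, ⟨?_, ?_⟩, by field_simp [ha.ne]; ring⟩
        · rw [le_div_iff_of_neg ha]; linarith
        · rw [div_le_iff_of_neg ha]; linarith
    rw [h2, Set.Icc_eq_Icc_iff (by nlinarith)] at him
    obtain ⟨h3, h4⟩ := him
    have ha' : P.a n = - 1 / T := by
      rw [eq_div_iff hT0.ne']
      apply mul_right_cancel₀ hs.ne'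
      rw [huv] at h3
      linarith
    intro t
    change P.a n * t + P.b n = _
    have hb : P.b n = p - P.a n * v := by linarith
    rw [hb, ha']
    ring
  · exfalso
    have h1 : p ∈ P.L n '' Set.Icc u v := him ▸ ⟨le_rfl, by linarith⟩
    have h2 : p + P.step ∈ P.L n '' Set.Icc u v := him ▸ ⟨by linarith, le_rfl⟩
    obtain ⟨s, -, hs1⟩ := h1
    obtain ⟨t, -, ht1⟩ := h2
    simp only [L, ha, zero_mul] at hs1 ht1
    linarith
  · left
    refine ⟨ha, ?_⟩
    rw [hL, Set.image_affine_Icc' ha, Set.Icc_eq_Icc_iff (by nlinarith)] at him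
    obtain ⟨h3, h4⟩ := him
    have ha' : P.a n = 1 / T := by
      rw [eq_div_iff hT0.ne']
      apply mul_right_cancel₀ hs.ne'
      rw [huv] at h4
      linarith
    intro t
    change P.a n * t + P.b n = _
    have hb : P.b n = p - P.a n * u := by linarith
    rw [hb, ha']
    ring

theorem grid_subset_Icc_iff (hT : 2 ≤ T) (m c u v : ℕ) :
    P.grid T m c ⊆ Set.Icc (P.x 0 + u * P.step) (P.x 0 + v * P.step) ↔
      u * T ^ m ≤ c ∧ c < v * T ^ m := by
  have hs := hP.step_pos
  have hT0 : (0 : ℝ) < (T : ℝ) ^ m := by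
    have : (0 : ℝ) < T := by exact_mod_cast (by omega : 0 < T)
    positivity
  have hd : 0 < P.step / (T : ℝ) ^ m := by positivity
  have he : P.step = (T : ℝ) ^ m * (P.step / (T : ℝ) ^ m) := by field_simp
  rw [grid, Set.Icc_subset_Icc_iff (by nlinarith)]
  set d := P.step / (T : ℝ) ^ m
  rw [he, ← Nat.succ_le_iff, add_le_add_iff_left, add_le_add_iff_left, ← mul_assoc, ← mul_assoc,
    mul_le_mul_iff_left₀ hd, mul_le_mul_iff_left₀ hd]
  norm_cast

theorem grid_subset_D_iff (hT : 2 ≤ T) (m c : ℕ) (n : Fin N) :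
    P.grid T m c ⊆ P.D n ↔ P.InDomain T m n c := by
  rw [hP.D_eq, hP.grid_subset_Icc_iff hT, InDomain]

theorem grid_succ_subset_iff (hT : 2 ≤ T) (m c c' : ℕ) :
    P.grid T (m + 1) c ⊆ P.grid T m c' ↔ c / T = c' := by
  have hs := hP.step_pos
  have hT1 : (0 : ℝ) < T := by exact_mod_cast (by omega : 0 < T)
  have hd : 0 < P.step / (T : ℝ) ^ (m + 1) := by positivity
  have he : P.step / (T : ℝ) ^ m = T * (P.step / (T : ℝ) ^ (m + 1)) := by
    rw [pow_succ]; field_simp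
  rw [grid, grid, Set.Icc_subset_Icc_iff (by nlinarith)]
  rw [he]
  set d := P.step / (T : ℝ) ^ (m + 1)
  rw [add_le_add_iff_left, add_le_add_iff_left, ← mul_assoc, ← mul_assoc,
    mul_le_mul_iff_left₀ hd, mul_le_mul_iff_left₀ hd]
  norm_cast
  rw [Nat.div_eq_iff (by omega)]
  have : (c' + 1) * T = c' * T + T := by ring
  omega

theorem grid_injective (hT : 2 ≤ T) (m : ℕ) : Function.Injective (P.grid T m) := by
  intro c c' h
  have hs := hP.step_pos
  have hT1 : (0 : ℝ) < T := by exact_mod_cast (by omega : 0 < T)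
  have hd : 0 < P.step / (T : ℝ) ^ m := by positivity
  rw [grid, grid, Set.Icc_eq_Icc_iff (by nlinarith), add_right_inj, mul_left_inj' hd.ne'] at h
  exact_mod_cast h.1

theorem image_grid (hT : 2 ≤ T) {n : Fin N} (hn : (P.hi n : ℕ) = P.lo n + T) {m c : ℕ}
    (hc : P.InDomain T m n c) :
    P.L n '' P.grid T m c = P.grid T (m + 1) (P.childCode T m n c) := by
  have hT1 : (0 : ℝ) < T := by exact_mod_cast (by omega : 0 < T)
  obtain ⟨hc1, hc2⟩ := hc
  have he : P.step / (T : ℝ) ^ m = T * (P.step / (T : ℝ) ^ (m + 1)) := by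
    rw [pow_succ]; field_simp
  have he' : P.step = (T : ℝ) ^ (m + 1) * (P.step / (T : ℝ) ^ (m + 1)) := by field_simp
  rw [grid, grid, he]
  set d := P.step / (T : ℝ) ^ (m + 1)
  rcases hP.L_eq hT hn with ⟨ha, hL⟩ | ⟨ha, hL⟩
  · rw [childCode, if_pos ha]
    have hfun : P.L n = fun t => (1 / (T : ℝ)) * t +
        (P.x 0 + (n : ℕ) * P.step - (P.x 0 + (P.lo n : ℕ) * P.step) / T) := by
      ext t; rw [hL]; ring
    rw [hfun, Set.image_affine_Icc' (by positivity)]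
    push_cast [Nat.cast_sub hc1]
    rw [he']
    congr 1 <;> (field_simp; ring)
  · rw [childCode, if_neg ha]
    have hfun : P.L n = (fun t => (1 / (T : ℝ)) * t +
        (P.x 0 + (n : ℕ) * P.step + (P.x 0 + (P.hi n : ℕ) * P.step) / T)) ∘ Neg.neg := by
      ext t; rw [hL, Function.comp]; ring
    have hsub : (((P.hi n : ℕ) * T ^ m - 1 - c : ℕ) : ℝ) = (P.hi n : ℕ) * (T : ℝ) ^ m - 1 - c := by
      rw [Nat.cast_sub (by omega), Nat.cast_sub (by omega)]; push_cast; ring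
    rw [hfun, Set.image_comp, Set.image_neg_eq_neg, Set.neg_Icc,
      Set.image_affine_Icc' (by positivity), Nat.cast_add, hsub]
    push_cast
    rw [he']
    congr 1 <;> (field_simp; ring)

end IsGeneralizedAffine

/-- The endpoints of `D_n` are nodes, hence grid points of every level, so a cell lies in `D_n`
exactly when its parent does. -/
theorem inDomain_div_iff (hT : 2 ≤ T) {m c : ℕ} {n : Fin N} :
    P.InDomain T m n (c / T) ↔ P.InDomain T (m + 1) n c := by
  unfold InDomain
  rw [Nat.le_div_iff_mul_le (by omega), Nat.div_lt_iff_lt_mul (by omega), pow_succ, mul_assoc,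
    mul_assoc]

theorem childCode_div_pow (hT : 2 ≤ T) {m c : ℕ} {n : Fin N} (hn : (P.hi n : ℕ) = P.lo n + T)
    (hc : P.InDomain T m n c) : P.childCode T m n c / T ^ (m + 1) = n := by
  obtain ⟨h1, h2⟩ := hc
  have hpos : 0 < T ^ (m + 1) := by positivity
  have hlt : (P.hi n : ℕ) * T ^ m = (P.lo n : ℕ) * T ^ m + T ^ (m + 1) := by
    rw [hn, pow_succ]; ring
  unfold childCode
  split_ifs <;>
  · rw [mul_comm, Nat.mul_add_div hpos, Nat.div_eq_of_lt (by omega), add_zero]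

theorem childCode_succ_div (hT : 2 ≤ T) {m c : ℕ} {n : Fin N}
    (hc : P.InDomain T (m + 1) n c) :
    P.childCode T (m + 1) n c / T = P.childCode T m n (c / T) := by
  obtain ⟨h1, h2⟩ := hc
  have hpos : 0 < T := by omega
  unfold childCode
  rw [pow_succ] at h1 h2
  rw [← mul_assoc] at h1 h2
  have hn : (n : ℕ) * T ^ (m + 1 + 1) = T * ((n : ℕ) * T ^ (m + 1)) := by ring
  rw [hn]
  split_ifs
  · rw [Nat.mul_add_div hpos]
    congr 1
    rw [pow_succ, ← mul_assoc, mul_comm _ T, Nat.sub_mul_div]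
  · rw [Nat.mul_add_div hpos]
    congr 1
    rw [pow_succ, ← mul_assoc]
    generalize (P.hi n : ℕ) * T ^ m = w at *
    have hq := Nat.div_add_mod c T
    have hr := Nat.mod_lt c hpos
    have hlt : c / T < w := by rwa [Nat.div_lt_iff_lt_mul hpos]
    -- Reversing the order of cells reverses parents and the position within a parent separately:
    -- the quotient becomes `e`, the remainder `T - 1 - c % T`.
    obtain ⟨e, he⟩ : ∃ e, w = c / T + 1 + e := ⟨w - (c / T + 1), by omega⟩
    have hw : w * T = T * (c / T) + T + T * e := by rw [he]; ring
    have h3 : w * T - 1 - c = T * e + (T - 1 - c % T) := by omega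
    rw [h3, Nat.mul_add_div hpos, Nat.div_eq_of_lt (by omega)]
    omega

theorem owner_mem (m : ℕ) (i : CellIndex Λ T m) : owner Λ T m i ∈ Λ :=
  Finset.orderEmbOfFin_mem Λ rfl _

theorem code_div_pow (m : ℕ) (i : CellIndex Λ T (m + 1)) :
    code Λ T m i / T ^ m = owner Λ T (m + 1) i := by
  have h : ((i.modNat : Fin (T ^ (m + 1 - 1))) : ℕ) < T ^ m := i.modNat.2
  rw [code, mul_comm, Nat.mul_add_div (by omega), Nat.div_eq_of_lt h, add_zero]

theorem code_injective (m : ℕ) : Function.Injective (code Λ T m) := by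
  intro i j h
  have ho : owner Λ T (m + 1) i = owner Λ T (m + 1) j := by
    apply Fin.ext
    rw [← code_div_pow, ← code_div_pow, h]
  have hm : i.modNat = j.modNat := by
    apply Fin.ext
    unfold code at h
    rw [ho] at h
    omega
  have hd : i.divNat = j.divNat := (Λ.orderEmbOfFin rfl).injective ho
  apply finProdFinEquiv.symm.injective
  exact Prod.ext hd hm

theorem exists_code_eq {m c : ℕ} {n : Fin N} (hT : 2 ≤ T) (hn : n ∈ Λ) (hc : c / T ^ m = n) :
    ∃ i, code Λ T m i = c := by
  have hpos : 0 < T ^ m := by positivity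
  obtain ⟨s, rfl⟩ : ∃ s, Λ.orderEmbOfFin rfl s = n := by
    have : n ∈ Set.range (Λ.orderEmbOfFin rfl) := by simpa using hn
    exact this
  let i : CellIndex Λ T (m + 1) := finProdFinEquiv (s, ⟨c % T ^ m, Nat.mod_lt _ hpos⟩)
  have h := finProdFinEquiv.symm_apply_apply
    ((s, ⟨c % T ^ m, Nat.mod_lt _ hpos⟩) : Fin Λ.card × Fin (T ^ m))
  have h1 : i.divNat = s := congrArg Prod.fst h
  have h2 : i.modNat = ⟨c % T ^ m, Nat.mod_lt _ hpos⟩ := congrArg Prod.snd h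
  refine ⟨i, ?_⟩
  rw [code, owner, h1, h2, ← hc]
  exact Nat.div_add_mod' c (T ^ m)

theorem IsGeneralizedAffine.cell_eq (hP : P.IsGeneralizedAffine) (m : ℕ)
    (i : CellIndex Λ T (m + 1)) : P.cell Λ T (m + 1) i = P.grid T m (code Λ T m i) := by
  have hT : 0 < T ^ m := Nat.pos_of_mul_pos_left i.pos
  have hT0 : (0 : ℝ) < (T : ℝ) ^ m := by exact_mod_cast hT
  have hN : (0 : ℝ) < N := by
    have := hP.two_le
    exact_mod_cast (by omega : 0 < N)
  rw [cell, grid, hP.x_eq (owner Λ T (m + 1) i).castSucc, Fin.val_castSucc, code, step]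
  push_cast
  congr 1 <;> (field_simp; ring)

end RecurrentData

/-! ### Basic cells and the parent map. -/

namespace RecurrentData

variable {N : ℕ} {P : RecurrentData N} {Λ : Finset (Fin N)} {T : ℕ}

theorem basicCodes_div_pow (hT : 2 ≤ T) (hn : ∀ n ∈ Λ, (P.hi n : ℕ) = P.lo n + T) {m c : ℕ}
    (hc : c ∈ P.basicCodes Λ T m) : ∃ n ∈ Λ, c / T ^ m = (n : ℕ) := by
  cases m with
  | zero =>
    obtain ⟨n, h, rfl⟩ := hc
    exact ⟨n, h, by simp⟩
  | succ m =>
    obtain ⟨n, h, c', -, hd, rfl⟩ := hc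
    exact ⟨n, h, childCode_div_pow hT (hn n h) hd⟩

theorem div_mem_basicCodes (hT : 2 ≤ T) (hn : ∀ n ∈ Λ, (P.hi n : ℕ) = P.lo n + T) {m c : ℕ}
    (hc : c ∈ P.basicCodes Λ T (m + 1)) : c / T ∈ P.basicCodes Λ T m := by
  induction m generalizing c with
  | zero =>
    obtain ⟨n, h, c', -, hd, rfl⟩ := hc
    have := childCode_div_pow hT (hn n h) hd
    change _ / T ^ 1 = _ at this
    rw [pow_one] at this
    exact ⟨n, h, this⟩
  | succ m ih =>
    obtain ⟨n, h, c', hc', hd, rfl⟩ := hc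
    exact ⟨n, h, c' / T, ih hc', (inDomain_div_iff hT).2 hd, childCode_succ_div hT hd⟩

theorem IsComponent.exists_edge_to (hΛ : P.IsComponent Λ) {n : Fin N} (hn : n ∈ Λ) :
    ∃ j ∈ Λ, P.I j ⊆ P.D n := by
  obtain ⟨j, -, hj, -, h⟩ := Relation.TransGen.tail'_iff.1 (hΛ.prop.2 n hn n hn)
  exact ⟨j, hj, h⟩

theorem IsComponent.exists_edge_from (hΛ : P.IsComponent Λ) {n : Fin N} (hn : n ∈ Λ) :
    ∃ j ∈ Λ, P.I n ⊆ P.D j := by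
  obtain ⟨j, ⟨-, hj, h⟩, -⟩ := Relation.TransGen.head'_iff.1 (hΛ.prop.2 n hn n hn)
  exact ⟨j, hj, h⟩

/-- Every vertex of `Λ` has an incoming edge inside `Λ`, so each `I_n` contains a finer basic cell;
applying the maps `L_n` propagates this to all levels. -/
theorem exists_mem_basicCodes_div_eq (hP : P.IsGeneralizedAffine) (hΛ : P.IsComponent Λ)
    (hT : 2 ≤ T) (hn : ∀ n ∈ Λ, (P.hi n : ℕ) = P.lo n + T) {m c : ℕ}
    (hc : c ∈ P.basicCodes Λ T m) : ∃ c' ∈ P.basicCodes Λ T (m + 1), c' / T = c := by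
  induction m generalizing c with
  | zero =>
    obtain ⟨n, h, rfl⟩ := hc
    obtain ⟨j, hj, hjn⟩ := hΛ.exists_edge_to h
    rw [hP.I_eq_grid (T := T), hP.grid_subset_D_iff hT] at hjn
    refine ⟨_, ⟨n, h, j, ⟨j, hj, rfl⟩, hjn, rfl⟩, ?_⟩
    have := childCode_div_pow hT (hn n h) hjn
    rwa [zero_add, pow_one] at this
  | succ m ih =>
    obtain ⟨n, h, c', hc', hd, rfl⟩ := hc
    obtain ⟨e, he, rfl⟩ := ih hc'
    have hd' := (inDomain_div_iff hT).1 hd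
    exact ⟨_, ⟨n, h, e, he, hd', rfl⟩, childCode_succ_div hT hd'⟩

namespace IsGeneralizedAffine

variable (hP : P.IsGeneralizedAffine)
include hP

theorem basicIntervals_eq (hT : 2 ≤ T) (hn : ∀ n ∈ Λ, (P.hi n : ℕ) = P.lo n + T) (m : ℕ) :
    P.basicIntervals Λ (m + 1) = P.grid T m '' P.basicCodes Λ T m := by
  induction m with
  | zero =>
    ext E
    constructor
    · rintro ⟨n, h, -, ⟨n', h', rfl⟩, hsub, rfl⟩
      refine ⟨n, ⟨n, h, rfl⟩, ?_⟩
      -- All domains indexed by `Λ` have the same length, so the inclusion `D_{n'} ⊆ D_n` is an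
      -- equality.
      have hlt : P.x (P.lo n') ≤ P.x (P.hi n') := (hP.x_strictMono (hP.lo_lt_hi n')).le
      have h2 := (Set.Icc_subset_Icc_iff hlt).1 hsub
      rw [hP.x_strictMono.le_iff_le, hP.x_strictMono.le_iff_le, Fin.le_def, Fin.le_def, hn n h,
        hn n' h'] at h2
      have hlo : P.lo n' = P.lo n := Fin.ext (by omega)
      have hhi : P.hi n' = P.hi n := Fin.ext (by rw [hn n h, hn n' h', hlo])
      have hD : P.D n' = P.D n := by rw [D, D, hlo, hhi]
      rw [hD, (hP.L_bijOn n).image_eq, hP.I_eq_grid]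
    · rintro ⟨-, ⟨n, h, rfl⟩, rfl⟩
      exact ⟨n, h, _, ⟨n, h, rfl⟩, subset_rfl, by
        rw [(hP.L_bijOn n).image_eq, hP.I_eq_grid]⟩
  | succ m ih =>
    ext E
    rw [basicIntervals, ih]
    constructor
    · rintro ⟨n, h, -, ⟨c, hc, rfl⟩, hsub, rfl⟩
      rw [hP.grid_subset_D_iff hT] at hsub
      exact ⟨_, ⟨n, h, c, hc, hsub, rfl⟩, (hP.image_grid hT (hn n h) hsub).symm⟩
    · rintro ⟨-, ⟨n, h, c, hc, hd, rfl⟩, rfl⟩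
      exact ⟨n, h, _, ⟨c, hc, rfl⟩, (hP.grid_subset_D_iff hT _ _ _).2 hd,
        (hP.image_grid hT (hn n h) hd).symm⟩

theorem mem_Theta_iff (hT : 2 ≤ T) (hn : ∀ n ∈ Λ, (P.hi n : ℕ) = P.lo n + T) {m : ℕ}
    {i : CellIndex Λ T (m + 1)} :
    i ∈ P.Theta Λ T (m + 1) ↔ code Λ T m i ∈ P.basicCodes Λ T m := by
  simp only [Theta, Finset.mem_filter, Finset.mem_univ, true_and]
  rw [hP.basicIntervals_eq hT hn, hP.cell_eq, (hP.grid_injective hT m).mem_set_image]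

theorem cell_subset_cellPreimage_iff (hT : 2 ≤ T) (hn : ∀ n ∈ Λ, (P.hi n : ℕ) = P.lo n + T)
    {m : ℕ} {i j : CellIndex Λ T (m + 1)} :
    P.cell Λ T (m + 1) j ⊆ P.cellPreimage Λ T (m + 1) i ↔
      P.InDomain T m (owner Λ T (m + 1) i) (code Λ T m j) ∧
        P.childCode T m (owner Λ T (m + 1) i) (code Λ T m j) / T = code Λ T m i := by
  rw [cellPreimage, Set.subset_inter_iff, hP.cell_eq, hP.cell_eq, hP.grid_subset_D_iff hT,
    ← Set.image_subset_iff]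
  refine and_congr_right fun h => ?_
  rw [hP.image_grid hT (hn _ (owner_mem _ i)) h, hP.grid_succ_subset_iff hT]

theorem grid_subset_grid_div (hT : 2 ≤ T) (m c : ℕ) :
    P.grid T (m + 1) c ⊆ P.grid T m (c / T) :=
  (hP.grid_succ_subset_iff hT m c _).2 rfl

theorem grid_nonempty (m c : ℕ) : (P.grid T m c).Nonempty := by
  have := hP.step_pos
  refine Set.nonempty_Icc.2 ?_
  have : 0 ≤ P.step / (T : ℝ) ^ m := by positivity
  nlinarith

theorem bddAbove_abs_S {n : Fin N} {E : Set ℝ} (h : E ⊆ P.D n) :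
    BddAbove ((fun t => |P.S n t|) '' E) :=
  ⟨1, by rintro - ⟨t, ht, rfl⟩; exact (hP.S_abs_lt_one n t (h ht)).le⟩

omit hP in
theorem bddBelow_abs_S (n : Fin N) (E : Set ℝ) : BddBelow ((fun t => |P.S n t|) '' E) :=
  ⟨0, by rintro - ⟨t, -, rfl⟩; exact abs_nonneg _⟩

omit hP in
theorem upperMatrix_nonneg (k : ℕ) (i j : CellIndex Λ T k) : 0 ≤ P.upperMatrix Λ T k i j := by
  rw [upperMatrix, Matrix.of_apply]
  split_ifs
  · exact Real.sSup_nonneg (by rintro - ⟨t, -, rfl⟩; exact abs_nonneg _)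
  · exact le_rfl

omit hP in
theorem lowerMatrix_nonneg (k : ℕ) (i j : CellIndex Λ T k) : 0 ≤ P.lowerMatrix Λ T k i j := by
  rw [lowerMatrix, Matrix.of_apply]
  split_ifs
  · exact Real.sInf_nonneg (by rintro - ⟨t, -, rfl⟩; exact abs_nonneg _)
  · exact le_rfl

theorem upperMatrix_le_mul_lowerMatrix {k : ℕ} {i j : CellIndex Λ T (k + 1)} {c : ℝ}
    (h : P.cell Λ T (k + 1) j ⊆ P.cellPreimage Λ T (k + 1) i →
      ∀ s ∈ P.cell Λ T (k + 1) j, ∀ t ∈ P.cell Λ T (k + 1) j,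
        |P.S (owner Λ T (k + 1) i) s| ≤ c * |P.S (owner Λ T (k + 1) i) t|) (hc : 0 < c) :
    P.upperMatrix Λ T (k + 1) i j ≤ c * P.lowerMatrix Λ T (k + 1) i j := by
  rw [upperMatrix, lowerMatrix, Matrix.of_apply, Matrix.of_apply]
  split_ifs with hs
  · have hne : (P.cell Λ T (k + 1) j).Nonempty := hP.cell_eq k j ▸ hP.grid_nonempty _ _
    refine csSup_le (hne.image _) ?_
    rintro - ⟨s, hs', rfl⟩
    rw [← div_le_iff₀' hc]
    refine le_csInf (hne.image _) ?_
    rintro - ⟨t, ht, rfl⟩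
    rw [div_le_iff₀' hc]
    exact h hs s hs' t ht
  · simp

theorem lowerMatrix_le_upperMatrix (k : ℕ) (i j : CellIndex Λ T (k + 1)) :
    P.lowerMatrix Λ T (k + 1) i j ≤ P.upperMatrix Λ T (k + 1) i j := by
  rw [upperMatrix, lowerMatrix, Matrix.of_apply, Matrix.of_apply]
  split_ifs with h
  · obtain ⟨t, ht⟩ : (P.cell Λ T (k + 1) j).Nonempty := hP.cell_eq k j ▸ hP.grid_nonempty _ _
    exact (csInf_le (bddBelow_abs_S _ _) ⟨t, ht, rfl⟩).trans
      (le_csSup (hP.bddAbove_abs_S (h.trans Set.inter_subset_left)) ⟨t, ht, rfl⟩)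
  · exact le_rfl

theorem lowerRadius_le_upperRadius (m : ℕ) :
    P.lowerRadius Λ T (m + 1) ≤ P.upperRadius Λ T (m + 1) := by
  exact matrixSpectralRadius_mono (fun _ _ => lowerMatrix_nonneg _ _ _)
    fun i j => hP.lowerMatrix_le_upperMatrix m i.1 j.1

theorem exists_parent (hT : 2 ≤ T) (hn : ∀ n ∈ Λ, (P.hi n : ℕ) = P.lo n + T) (m : ℕ) :
    ∃ π : P.Theta Λ T (m + 1 + 1) → P.Theta Λ T (m + 1),
      ∀ j, code Λ T m (π j) = code Λ T (m + 1) j / T := by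
  have (j : P.Theta Λ T (m + 1 + 1)) : ∃ i : P.Theta Λ T (m + 1),
      code Λ T m i = code Λ T (m + 1) j / T := by
    have hj := div_mem_basicCodes hT hn ((hP.mem_Theta_iff hT hn).1 j.2)
    obtain ⟨n, h, hd⟩ := basicCodes_div_pow hT hn hj
    obtain ⟨i, hi⟩ := exists_code_eq hT h hd
    exact ⟨⟨i, (hP.mem_Theta_iff hT hn).2 (hi ▸ hj)⟩, hi⟩
  choose π hπ using this
  exact ⟨π, hπ⟩

theorem parent_surjective (hΛ : P.IsComponent Λ) (hT : 2 ≤ T)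
    (hn : ∀ n ∈ Λ, (P.hi n : ℕ) = P.lo n + T) {m : ℕ}
    {π : P.Theta Λ T (m + 1 + 1) → P.Theta Λ T (m + 1)}
    (hπ : ∀ j, code Λ T m (π j) = code Λ T (m + 1) j / T) : Function.Surjective π := by
  intro i
  obtain ⟨c, hc, hci⟩ := exists_mem_basicCodes_div_eq hP hΛ hT hn ((hP.mem_Theta_iff hT hn).1 i.2)
  obtain ⟨n, h, hd⟩ := basicCodes_div_pow hT hn hc
  obtain ⟨j, rfl⟩ := exists_code_eq hT h hd
  refine ⟨⟨j, (hP.mem_Theta_iff hT hn).2 hc⟩, Subtype.ext (code_injective m ?_)⟩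
  rw [hπ, hci]

/-! ### Comparison of the scaling matrices of consecutive levels. -/

section Parent

variable (hT : 2 ≤ T) (hn : ∀ n ∈ Λ, (P.hi n : ℕ) = P.lo n + T) {m : ℕ}
  {π : P.Theta Λ T (m + 1 + 1) → P.Theta Λ T (m + 1)}
  (hπ : ∀ j, code Λ T m (π j) = code Λ T (m + 1) j / T)
include hT hπ

omit hP hT in
theorem owner_parent (j : P.Theta Λ T (m + 1 + 1)) :
    owner Λ T (m + 1) (π j) = owner Λ T (m + 1 + 1) j := by
  apply Fin.ext
  rw [← code_div_pow, ← code_div_pow, hπ, Nat.div_div_eq_div_mul, pow_succ, mul_comm]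

theorem cell_subset_cell_parent (j : P.Theta Λ T (m + 1 + 1)) :
    P.cell Λ T (m + 1 + 1) j ⊆ P.cell Λ T (m + 1) (π j) := by
  rw [hP.cell_eq, hP.cell_eq, hπ]
  exact hP.grid_subset_grid_div hT _ _

include hn

/-- `L_n` maps the parent of `j` onto a single cell of the finer level, which must be `i`. Thus `π
i` and `j` determine `i`, and each fibre receives at most one edge from `j`. -/
theorem code_eq_of_edge {i j : P.Theta Λ T (m + 1 + 1)}
    (h : P.cell Λ T (m + 1 + 1) j ⊆ P.cellPreimage Λ T (m + 1 + 1) i) :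
    code Λ T (m + 1) i = P.childCode T m (owner Λ T (m + 1) (π i)) (code Λ T m (π j)) := by
  obtain ⟨h1, h2⟩ := (hP.cell_subset_cellPreimage_iff hT hn).1 h
  rw [← h2, childCode_succ_div hT h1, hπ, owner_parent hπ]

theorem edge_parent {i j : P.Theta Λ T (m + 1 + 1)}
    (h : P.cell Λ T (m + 1 + 1) j ⊆ P.cellPreimage Λ T (m + 1 + 1) i) :
    P.cell Λ T (m + 1) (π j) ⊆ P.cellPreimage Λ T (m + 1) (π i) := by
  have h3 := hP.code_eq_of_edge hT hn hπ h
  obtain ⟨h1, h2⟩ := (hP.cell_subset_cellPreimage_iff hT hn).1 h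
  rw [hP.cell_subset_cellPreimage_iff hT hn, ← h3, hπ i, hπ j, owner_parent hπ,
    inDomain_div_iff hT]
  exact ⟨h1, rfl⟩

/-- The target is the image of the cell of `π j` under `L_n`, with `n` the owner of `i`; it is basic
because the cell of `π j` is. -/
theorem exists_edge_of_edge_parent {i : P.Theta Λ T (m + 1)} {j : P.Theta Λ T (m + 1 + 1)}
    (h : P.cell Λ T (m + 1) (π j) ⊆ P.cellPreimage Λ T (m + 1) i) :
    ∃ i', π i' = i ∧ P.cell Λ T (m + 1 + 1) j ⊆ P.cellPreimage Λ T (m + 1 + 1) i' := by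
  obtain ⟨h1, h2⟩ := (hP.cell_subset_cellPreimage_iff hT hn).1 h
  have ho := owner_mem (m + 1) (i : CellIndex Λ T (m + 1))
  have hmem : P.childCode T m (owner Λ T (m + 1) i) (code Λ T m (π j)) ∈
      P.basicCodes Λ T (m + 1) :=
    ⟨_, ho, _, (hP.mem_Theta_iff hT hn).1 (π j).2, h1, rfl⟩
  have hdiv := childCode_div_pow hT (hn _ ho) h1
  obtain ⟨i', hi'⟩ := exists_code_eq hT ho hdiv
  have hpar : π ⟨i', (hP.mem_Theta_iff hT hn).2 (hi' ▸ hmem)⟩ = i :=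
    Subtype.ext (code_injective m (by rw [hπ, hi', h2]))
  refine ⟨_, hpar, ?_⟩
  have hown := owner_parent hπ ⟨i', (hP.mem_Theta_iff hT hn).2 (hi' ▸ hmem)⟩
  rw [hpar] at hown
  rw [hπ] at h1
  rw [hP.cell_subset_cellPreimage_iff hT hn, ← hown]
  have h1' := (inDomain_div_iff hT).1 h1
  exact ⟨h1', by rw [childCode_succ_div hT h1', hi', hπ]⟩

theorem sum_fiber_upperMatrix_le (i : P.Theta Λ T (m + 1)) (j : P.Theta Λ T (m + 1 + 1)) :
    ∑ i' with π i' = i, P.upperMatrix Λ T (m + 1 + 1) i' j ≤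
      P.upperMatrix Λ T (m + 1) i (π j) := by
  by_cases hex : ∃ i', π i' = i ∧ P.cell Λ T (m + 1 + 1) j ⊆ P.cellPreimage Λ T (m + 1 + 1) i'
  · obtain ⟨i', rfl, he⟩ := hex
    rw [Finset.sum_eq_single i']
    · have hp := hP.edge_parent hT hn hπ he
      rw [upperMatrix, upperMatrix, Matrix.of_apply, Matrix.of_apply, if_pos he, if_pos hp,
        owner_parent hπ]
      have hne : (P.cell Λ T (m + 1 + 1) j).Nonempty :=
        hP.cell_eq (m + 1) j.1 ▸ hP.grid_nonempty _ _
      refine csSup_le_csSup (hP.bddAbove_abs_S ?_) (hne.image _)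
        (Set.image_mono (hP.cell_subset_cell_parent hT hπ j))
      have := hp.trans Set.inter_subset_left
      rwa [owner_parent hπ] at this
    · intro l hl hne
      rw [upperMatrix, Matrix.of_apply, if_neg]
      intro hl'
      refine hne (Subtype.ext (code_injective (m + 1) ?_))
      rw [hP.code_eq_of_edge hT hn hπ he, hP.code_eq_of_edge hT hn hπ hl',
        (Finset.mem_filter.1 hl).2]
    · simp
  · push Not at hex
    rw [Finset.sum_eq_zero]
    · exact upperMatrix_nonneg _ _ _
    · intro l hl
      rw [upperMatrix, Matrix.of_apply, if_neg (hex l (Finset.mem_filter.1 hl).2)]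

theorem le_sum_fiber_lowerMatrix (i : P.Theta Λ T (m + 1)) (j : P.Theta Λ T (m + 1 + 1)) :
    P.lowerMatrix Λ T (m + 1) i (π j) ≤
      ∑ i' with π i' = i, P.lowerMatrix Λ T (m + 1 + 1) i' j := by
  by_cases he : P.cell Λ T (m + 1) (π j) ⊆ P.cellPreimage Λ T (m + 1) i
  · obtain ⟨i', rfl, he'⟩ := hP.exists_edge_of_edge_parent hT hn hπ he
    refine le_trans ?_ (Finset.single_le_sum (fun l _ => lowerMatrix_nonneg _ _ _)
      (Finset.mem_filter.2 ⟨Finset.mem_univ i', rfl⟩))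
    rw [lowerMatrix, lowerMatrix, Matrix.of_apply, Matrix.of_apply, if_pos he, if_pos he',
      owner_parent hπ]
    have hne : (P.cell Λ T (m + 1 + 1) j).Nonempty :=
      hP.cell_eq (m + 1) j.1 ▸ hP.grid_nonempty _ _
    exact csInf_le_csInf (bddBelow_abs_S _ _) (hne.image _)
      (Set.image_mono (hP.cell_subset_cell_parent hT hπ j))
  · rw [lowerMatrix, Matrix.of_apply, if_neg he]
    exact Finset.sum_nonneg fun l _ => lowerMatrix_nonneg _ _ _

end Parent

theorem upperRadius_succ_le (hT : 2 ≤ T) (hn : ∀ n ∈ Λ, (P.hi n : ℕ) = P.lo n + T) (m : ℕ) :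
    P.upperRadius Λ T (m + 1 + 1) ≤ P.upperRadius Λ T (m + 1) := by
  obtain ⟨π, hπ⟩ := hP.exists_parent hT hn m
  exact matrixSpectralRadius_le_of_fiber_le π (fun _ _ => upperMatrix_nonneg _ _ _)
    (fun _ _ => upperMatrix_nonneg _ _ _) (hP.sum_fiber_upperMatrix_le hT hn hπ)

theorem le_lowerRadius_succ (hΛ : P.IsComponent Λ) (hT : 2 ≤ T)
    (hn : ∀ n ∈ Λ, (P.hi n : ℕ) = P.lo n + T) (m : ℕ) :
    P.lowerRadius Λ T (m + 1) ≤ P.lowerRadius Λ T (m + 1 + 1) := by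
  obtain ⟨π, hπ⟩ := hP.exists_parent hT hn m
  exact le_matrixSpectralRadius_of_le_fiber π (hP.parent_surjective hΛ hT hn hπ)
    (fun _ _ => lowerMatrix_nonneg _ _ _)
    (fun _ _ => lowerMatrix_nonneg _ _ _) (hP.le_sum_fiber_lowerMatrix hT hn hπ)

/-! ### Positivity on the limit set and the ratio of maxima to minima. -/

omit hP in
theorem continuous_L (n : Fin N) : Continuous (P.L n) := by
  unfold L
  fun_prop

omit hP in
theorem isCompact_basicSet (k : ℕ) : IsCompact (P.basicSet Λ k) := by
  induction k with
  | zero => exact Λ.isCompact_biUnion fun n _ => isCompact_Icc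
  | succ k ih =>
    exact Λ.isCompact_biUnion fun n _ => (ih.inter_right isClosed_Icc).image (continuous_L n)

theorem antitone_basicSet (hΛ : P.IsComponent Λ) : Antitone (P.basicSet Λ) := by
  refine antitone_nat_of_succ_le fun k => ?_
  induction k with
  | zero =>
    refine Set.iUnion₂_subset fun n h => ?_
    obtain ⟨j, hj, hsub⟩ := hΛ.exists_edge_from h
    calc P.L n '' (P.basicSet Λ 0 ∩ P.D n) ⊆ P.L n '' P.D n := Set.image_mono Set.inter_subset_right
      _ = P.I n := (hP.L_bijOn n).image_eq
      _ ⊆ P.D j := hsub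
      _ ⊆ _ := Set.subset_biUnion_of_mem (u := fun n => P.D n) (Finset.mem_coe.2 hj)
  | succ k ih =>
    exact Set.iUnion₂_mono fun n _ => Set.image_mono (Set.inter_subset_inter_left _ ih)

omit hP in
theorem subset_basicSet {k : ℕ} {E : Set ℝ} (hE : E ∈ P.basicIntervals Λ k) :
    E ⊆ P.basicSet Λ k := by
  induction k generalizing E with
  | zero =>
    obtain ⟨n, h, rfl⟩ := hE
    exact Set.subset_biUnion_of_mem (u := fun n => P.D n) (Finset.mem_coe.2 h)
  | succ k ih =>
    obtain ⟨n, h, E', hE', hsub, rfl⟩ := hE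
    exact (Set.image_mono (Set.subset_inter (ih hE') hsub)).trans
      (Set.subset_biUnion_of_mem (u := fun n => P.L n '' (P.basicSet Λ k ∩ P.D n))
        (Finset.mem_coe.2 h))

/-- A scaling function that is positive on the limit set is bounded below by a positive constant on
some basic set. -/
theorem exists_pos_le_S (hΛ : P.IsComponent Λ) {n : Fin N}
    (hpos : ∀ t ∈ P.D n ∩ P.limitSet Λ, 0 < P.S n t) :
    ∃ c > 0, ∃ k, ∀ t ∈ P.D n ∩ P.basicSet Λ k, c ≤ P.S n t := by
  have hF : IsClosed (P.D n ∩ P.S n ⁻¹' Set.Iic 0) :=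
    (hP.S_continuousOn n).preimage_isClosed_of_isClosed isClosed_Icc isClosed_Iic
  -- Otherwise the nested compact sets `B_k ∩ D_n ∩ {S_n ≤ 0}` are all nonempty and share a point,
  -- which lies in `K`.
  obtain ⟨k, hk⟩ : ∃ k, ∀ t ∈ P.D n ∩ P.basicSet Λ k, 0 < P.S n t := by
    by_contra! hcon
    have hcomp (k : ℕ) : IsCompact (P.basicSet Λ k ∩ (P.D n ∩ P.S n ⁻¹' Set.Iic 0)) :=
      (isCompact_basicSet k).inter_right hF
    obtain ⟨t, ht⟩ := IsCompact.nonempty_iInter_of_sequence_nonempty_isCompact_isClosed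
      (fun k => P.basicSet Λ k ∩ (P.D n ∩ P.S n ⁻¹' Set.Iic 0))
      (fun k => Set.inter_subset_inter_left _ (hP.antitone_basicSet hΛ k.le_succ))
      (fun k => by
        obtain ⟨t, ⟨h1, h2⟩, h3⟩ := hcon k
        exact ⟨t, h2, h1, h3⟩)
      (hcomp 0) (fun k => (hcomp k).isClosed)
    rw [Set.mem_iInter] at ht
    exact (hpos t ⟨(ht 0).2.1, Set.mem_iInter.2 fun k => (ht k).1⟩).not_ge (ht 0).2.2
  have hcomp : IsCompact (P.D n ∩ P.basicSet Λ k) :=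
    isCompact_Icc.inter_right (isCompact_basicSet k).isClosed
  rcases (P.D n ∩ P.basicSet Λ k).eq_empty_or_nonempty with he | hne
  · exact ⟨1, one_pos, k, by simp [he]⟩
  · obtain ⟨s, hs, hmin⟩ := hcomp.exists_isMinOn hne
      ((hP.S_continuousOn n).mono Set.inter_subset_left)
    exact ⟨P.S n s, hk s hs, k, fun t ht => hmin ht⟩

theorem eventually_abs_S_le_mul (hΛ : P.IsComponent Λ) (hT : 2 ≤ T) {n : Fin N}
    (hpos : ∀ t ∈ P.D n ∩ P.limitSet Λ, 0 < P.S n t) {η : ℝ} (hη : 0 < η) :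
    ∀ᶠ m in atTop, ∀ c, P.grid T m c ⊆ P.D n ∩ P.basicSet Λ (m + 1) →
      ∀ s ∈ P.grid T m c, ∀ t ∈ P.grid T m c, |P.S n s| ≤ (1 + η) * |P.S n t| := by
  obtain ⟨b, hb, k, hk⟩ := hP.exists_pos_le_S hΛ hpos
  have huc := isCompact_Icc.uniformContinuousOn_of_continuous (hP.S_continuousOn n)
  -- With `b ≤ S_n(t)`, an oscillation below `η * b` is below `η * S_n(t)`, which turns the additive
  -- bound into a multiplicative one.
  obtain ⟨δ, hδ, hS⟩ := Metric.uniformContinuousOn_iff.1 huc (η * b) (by positivity)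
  have hlim : Tendsto (fun m : ℕ => P.step / (T : ℝ) ^ m) atTop (𝓝 0) :=
    (tendsto_pow_atTop_atTop_of_one_lt (by exact_mod_cast hT)).const_div_atTop _
  filter_upwards [hlim.eventually_lt_const hδ, eventually_ge_atTop k] with m hm hkm c hc s hs t ht
  have hsub : P.grid T m c ⊆ P.D n ∩ P.basicSet Λ k :=
    hc.trans (Set.inter_subset_inter_right _ (hP.antitone_basicSet hΛ (by omega)))
  have hs1 := hk s (hsub hs)
  have ht1 := hk t (hsub ht)
  have hd : dist s t < δ := by
    rw [grid] at hs ht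
    refine lt_of_le_of_lt (Real.dist_le_of_mem_Icc hs ht) ?_
    linarith
  have := hS s (hc hs).1 t (hc ht).1 hd
  rw [Real.dist_eq] at this
  have h2 := (abs_lt.1 this).2
  rw [abs_of_pos (hb.trans_le hs1), abs_of_pos (hb.trans_le ht1)]
  nlinarith

theorem eventually_upperRadius_le_mul (hΛ : P.IsComponent Λ) (hT : 2 ≤ T)
    (hpos : ∀ n ∈ Λ, ∀ t ∈ P.D n ∩ P.limitSet Λ, 0 < P.S n t) {η : ℝ} (hη : 0 < η) :
    ∀ᶠ m in atTop, P.upperRadius Λ T (m + 1) ≤ (1 + η) * P.lowerRadius Λ T (m + 1) := by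
  have hev : ∀ᶠ m in atTop, ∀ n ∈ Λ, ∀ c, P.grid T m c ⊆ P.D n ∩ P.basicSet Λ (m + 1) →
      ∀ s ∈ P.grid T m c, ∀ t ∈ P.grid T m c, |P.S n s| ≤ (1 + η) * |P.S n t| :=
    (Filter.eventually_all_finset Λ).2 fun n h => hP.eventually_abs_S_le_mul hΛ hT (hpos n h) hη
  filter_upwards [hev] with m hm
  refine matrixSpectralRadius_le_mul (by positivity) (fun _ _ => upperMatrix_nonneg _ _ _)
    (fun _ _ => lowerMatrix_nonneg _ _ _) fun i j => ?_
  refine hP.upperMatrix_le_mul_lowerMatrix (fun h => ?_) (by positivity)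
  -- The restriction to `Θ` matters here: it places the column's cell inside the basic set, where
  -- `S_n` is bounded away from zero.
  have hj : P.cell Λ T (m + 1) j ∈ P.basicIntervals Λ (m + 1) := by
    simpa [Theta] using j.2
  have hsub := Set.subset_inter (h.trans Set.inter_subset_left) (subset_basicSet hj)
  rw [hP.cell_eq] at hsub ⊢
  exact hm _ (owner_mem _ _) _ hsub

end IsGeneralizedAffine

end RecurrentData

/-! ### Convergence and equality of the limits. -/

theorem theorem2p2 {N : ℕ} (P : RecurrentData N) (hP : P.IsGeneralizedAffine)
    (Λ : Finset (Fin N)) (hΛ : P.IsComponent Λ)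
    (T : ℕ) (hT : 2 ≤ T)
    (hDI : ∀ n ∈ Λ, (P.x (P.hi n) - P.x (P.lo n)) / (P.x n.succ - P.x n.castSucc) = T) :
    ∃ ρ : ℝ,
      (AntitoneOn (fun k => P.upperRadius Λ T k) (Set.Ici 1) ∧
        Filter.Tendsto (fun k => P.upperRadius Λ T k) Filter.atTop (nhds ρ)) ∧
      (MonotoneOn (fun k => P.lowerRadius Λ T k) (Set.Ici 1) ∧
        (∃ σ : ℝ, Filter.Tendsto (fun k => P.lowerRadius Λ T k) Filter.atTop (nhds σ)) ∧
        ((∀ n ∈ Λ, ∀ t ∈ P.D n ∩ P.limitSet Λ, 0 < P.S n t) →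
          Filter.Tendsto (fun k => P.lowerRadius Λ T k) Filter.atTop (nhds ρ))) := by
  have hn : ∀ n ∈ Λ, (P.hi n : ℕ) = P.lo n + T := fun n h => hP.hi_eq (hDI n h)
  have hanti : Antitone fun m => P.upperRadius Λ T (m + 1) :=
    antitone_nat_of_succ_le (hP.upperRadius_succ_le hT hn)
  have hmono : Monotone fun m => P.lowerRadius Λ T (m + 1) :=
    monotone_nat_of_le_succ (hP.le_lowerRadius_succ hΛ hT hn)
  have hle (m : ℕ) := hP.lowerRadius_le_upperRadius (Λ := Λ) (T := T) m
  have hup := tendsto_atTop_ciInf hanti ⟨0, by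
    rintro - ⟨m, rfl⟩
    exact matrixSpectralRadius_nonneg _⟩
  have hlow := tendsto_atTop_ciSup hmono ⟨P.upperRadius Λ T 1, by
    rintro - ⟨m, rfl⟩
    exact (hle m).trans (hanti (Nat.zero_le m))⟩
  set ρ := ⨅ m, P.upperRadius Λ T (m + 1)
  set σ := ⨆ m, P.lowerRadius Λ T (m + 1)
  refine ⟨ρ, ⟨?_, (tendsto_add_atTop_iff_nat 1).1 hup⟩, ?_,
    ⟨σ, (tendsto_add_atTop_iff_nat 1).1 hlow⟩, fun hpos => ?_⟩
  · intro k hk l hl hkl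
    rw [Set.mem_Ici] at hk hl
    obtain ⟨k, rfl⟩ := Nat.exists_eq_add_of_le' hk
    obtain ⟨l, rfl⟩ := Nat.exists_eq_add_of_le' hl
    exact hanti (by omega)
  · intro k hk l hl hkl
    rw [Set.mem_Ici] at hk hl
    obtain ⟨k, rfl⟩ := Nat.exists_eq_add_of_le' hk
    obtain ⟨l, rfl⟩ := Nat.exists_eq_add_of_le' hl
    exact hmono (by omega)
  · have h1 : σ ≤ ρ := le_of_tendsto_of_tendsto' hlow hup hle
    have h2 (η : ℝ) (hη : 0 < η) : ρ ≤ (1 + η) * σ :=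
      le_of_tendsto_of_tendsto hup (hlow.const_mul _)
        (hP.eventually_upperRadius_le_mul hΛ hT hpos hη)
    have h3 : ρ ≤ σ := by
      have hl : Tendsto (fun η : ℝ => (1 + η) * σ) (𝓝[>] 0) (𝓝 ((1 + 0) * σ)) :=
        (Continuous.tendsto (by fun_prop) 0).mono_left nhdsWithin_le_nhds
      rw [add_zero, one_mul] at hl
      exact ge_of_tendsto hl (eventually_nhdsWithin_of_forall h2)
    rw [le_antisymm h3 h1]
    exact (tendsto_add_atTop_iff_nat 1).1 hlow
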